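/- Let $K$ be a field of characteristic $0$ and let $\mathfrak A$ be an arbitrary associative algebra over $K$ (not necessarily with unit). Write $[X,Y]=XY-YX$ and $X\diamond Y=\frac12(XY+YX)$, and for $k\ge 1$ and $X_1,\dots,X_k\in\mathfrak A$ put $$\mathrm{Sym}_k(X_1,\dots,X_k)=\frac1{k!}\sum_{\pi\in\Pi_k}X_{\pi(1)}X_{\pi(2)}\cdots X_{\pi(k)},$$ where $\Pi_k$ is the set of all permutations of $\{1,\dots,k\}$. Define rational numbers $c_h$, $h\ge1$, by $$c_1=\frac1{12},\qquad c_h=-\frac1{2h+1}\sum_{i=1}^{h-1}c_i\,c_{h-i}\quad\text{for } h>1 .$$ For $1\le h\le k/2$ and $\mathcal A,\mathcal B_1,\dots,\mathcal B_k\in\mathfrak A$ put $$C_{k,h}(\mathcal A;\mathcal B_1,\dots,\mathcal B_k)=\sum_{(i_1,\dots,i_{2h})}\mathrm{Sym}_{k-2h+1}\bigl([\cdots[[\mathcal A,\mathcal B_{i_1}],\mathcal B_{i_2}],\cdots,\mathcal B_{i_{2h}}],\mathcal B_{j_1},\dots,\mathcal B_{j_{k-2h}}\bigr),$$ where the sum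 is over all ordered $2h$-tuples of pairwise distinct indices in $\{1,\dots,k\}$, and $j_1<\dots<j_{k-2h}$ are the remaining indices. Then: 1. For all $\mathcal A,\mathcal B_1,\mathcal B_2\in\mathfrak A$, $$\mathcal A\diamond(\mathcal B_1\diamond\mathcal B_2)=\mathrm{Sym}_3(\mathcal A,\mathcal B_1,\mathcal B_2)+\frac1{12}\bigl([[\mathcal A,\mathcal B_1],\mathcal B_2]+[[\mathcal A,\mathcal B_2],\mathcal B_1]\bigr).$$ 2. For all $\mathcal A,\mathcal B_1,\mathcal B_2,\mathcal B_3\in\mathfrak A$, $$\begin{aligned}\mathcal A\diamond\mathrm{Sym}_3(\mathcal B_1,\mathcal B_2,\mathcal B_3)={}&\mathrm{Sym}_4(\mathcal A,\mathcal B_1,\mathcal B_2,\mathcal B_3)+\frac1{12}\Bigl\{\mathcal B_1\diamond\bigl([[\mathcal A,\mathcal B_2],\mathcal B_3]+[[\mathcal A,\mathcal B_3],\mathcal B_2]\bigr)\\&+\mathcal B_2\diamond\bigl([[\mathcal A,\mathcal B_1],\mathcal B_3]+[[\mathcal A,\mathcal B_3],\mathcal B_1]\bigr)+\mathcal B_3\diamond\bigl([[\mathcal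 A,\mathcal B_1],\mathcal B_2]+[[\mathcal A,\mathcal B_2],\mathcal B_1]\bigr)\Bigr\}.\end{aligned}$$ 3. In general, for every $k\ge1$ and all $\mathcal A,\mathcal B_1,\dots,\mathcal B_k\in\mathfrak A$, $$\mathcal A\diamond\mathrm{Sym}_k(\mathcal B_1,\dots,\mathcal B_k)=\mathrm{Sym}_{k+1}(\mathcal A,\mathcal B_1,\dots,\mathcal B_k)+\sum_{h=1}^{\lfloor k/2\rfloor}c_h\,C_{k,h}(\mathcal A;\mathcal B_1,\dots,\mathcal B_k).$$ 4. In particular, $c_2=-\frac1{720}$, $c_3=\frac1{30240}$, $c_4=-\frac1{1209600}$ and $c_5=\frac1{47900160}$. -/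

import Mathlib

namespace SymProd

/-- The product `a₁ a₂ ⋯ aₙ` of a nonempty list in a possibly non-unital ring. The value at the
empty list is a convention which plays no role for lists of length at least one. -/
def listProd {A : Type*} [NonUnitalRing A] : List A → A
  | [] => 0
  | a :: l => l.foldl (fun x y => x * y) a

theorem listProd_eq_prod {A : Type*} [Ring A] : ∀ l : List A, l ≠ [] → listProd l = l.prod
  | [], h => absurd rfl h
  | a :: l, _ => by
    simp only [listProd, List.prod_cons]
    induction l generalizing a with
    | nil => simp
    | cons b l ih => simp [ih, mul_assoc]

/-- The symmetrized product `Sym_n(v₁, …, vₙ) = (1/n!) ∑_π v_{π(1)} v_{π(2)} ⋯ v_{π(n)}`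
(for `n ≥ 1`), the sum being over all permutations of the `n` indices. -/
noncomputable def sym (K : Type*) {A : Type*} [Field K] [NonUnitalRing A] [Module K A]
    {n : ℕ} (v : Fin n → A) : A :=
  ((n.factorial : K))⁻¹ • ∑ π : Equiv.Perm (Fin n), listProd (List.ofFn fun i => v (π i))

/-- The symmetrized product of two elements, `a ⋄ b = (ab + ba)/2`. -/
noncomputable def diamond (K : Type*) {A : Type*} [Field K] [NonUnitalRing A] [Module K A]
    (a b : A) : A :=
  (1 / 2 : K) • (a * b + b * a)

theorem diamond_eq_sym (K : Type*) {A : Type*} [Field K] [NonUnitalRing A] [Module K A]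
    (a b : A) : diamond K a b = sym K ![a, b] := by
  have h : (Finset.univ : Finset (Equiv.Perm (Fin 2))) = {1, Equiv.swap 0 1} := by decide
  rw [diamond, sym, h, Finset.sum_pair (by decide)]
  simp [listProd]

/-- The iterated commutator `[⋯[[a, b₁], b₂], ⋯, bₘ]`, where `⁅x, y⁆ = x y - y x`. -/
def iterComm {A : Type*} [NonUnitalRing A] (a : A) {m : ℕ} (b : Fin m → A) : A :=
  (List.ofFn b).foldl (fun x y => ⁅x, y⁆) a

theorem card_compl_range {m k : ℕ} (i : Fin m ↪ Fin k) :
    ((Finset.univ.map i)ᶜ).card = k - m := by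
  simp [Finset.card_compl]

/-- The increasing enumeration `j₁ < ⋯ < j_{k-m}` of the indices in `{1, …, k}` which do not occur
among the pairwise distinct indices `i₁, …, iₘ`. -/
def restIdx {m k : ℕ} (i : Fin m ↪ Fin k) : Fin (k - m) ↪o Fin k :=
  ((Finset.univ.map i)ᶜ).orderEmbOfFin (card_compl_range i)

/-- `C_{k,h}(a; b₁, …, b_k)`: the sum, over all ordered tuples `(i₁, …, i_{2h})` of pairwise
distinct indices, of
`Sym_{k-2h+1}([⋯[a, b_{i₁}], ⋯, b_{i_{2h}}], b_{j₁}, …, b_{j_{k-2h}})`. -/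
noncomputable def commSum (K : Type*) {A : Type*} [Field K] [NonUnitalRing A] [Module K A]
    {k : ℕ} (h : ℕ) (a : A) (b : Fin k → A) : A :=
  ∑ i : Fin (2 * h) ↪ Fin k,
    sym K (Fin.cons (iterComm a fun s => b (i s)) fun t => b (restIdx i t) :
      Fin (k - 2 * h + 1) → A)

/-- The rational coefficients `c₁ = 1/12` and
`c_h = -(1/(2h+1)) (c₁ c_{h-1} + c₂ c_{h-2} + ⋯ + c_{h-1} c₁)` for `h > 1`
(the value at `0` is not used). -/
def coeff : ℕ → ℚ
  | 0 => 0
  | 1 => 1 / 12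
  | n + 2 => -(1 / (2 * ((n : ℚ) + 2) + 1)) *
      ∑ i : Fin (n + 1), coeff (i.val + 1) * coeff (n + 1 - i.val)
  decreasing_by all_goals omega

end SymProd

namespace SymProd

/-! For the general formula, both sides are symmetric and multilinear in the `b i`, so in
characteristic zero polarization reduces it to the diagonal case where every `b i` equals one
element `B`.

There everything is an operator applied to `a`. Let `x` and `y` be left and right multiplication by
`B`; they commute, and bracketing with `B` is `u = y - x`. The left side becomes `(x^k + y^k) / 2`,
a symmetrized product with one odd entry becomes the average of the `x^p * y^(n-p)`, and the claim
is a polynomial identity in commuting `x`, `y` (`half_add_pow_eq`). Setting `y = x + u` and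
comparing coefficients of `u^M * x^(k-M)`, it amounts to `f * (e^u - 1) = (u/2) * (e^u + 1)` for `f
= 1 + c₁ u² + c₂ u⁴ + ⋯`, that is, `f = (u/2) coth(u/2)`. The recursion for the `c_h` is the Riccati
equation `u f' = f + u²/4 - f²` of this function, read off coefficientwise.

The argument uses a unit; the non-unital case follows by embedding `A` in its unitization. The
formulas for two and three factors are checked by direct expansion. -/

theorem coeff_rec (h : ℕ) (hh : 1 < h) : coeff h = -(1 / (2 * (h : ℚ) + 1)) *
    ∑ i ∈ Finset.Icc 1 (h - 1), coeff i * coeff (h - i) := by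
  obtain ⟨n, rfl⟩ : ∃ n, h = n + 2 := ⟨h - 2, by omega⟩
  rw [coeff]
  have : Finset.Icc 1 (n + 2 - 1) = (Finset.range (n + 1)).map (addRightEmbedding 1) := by
    ext i
    simp only [Finset.mem_Icc, Finset.mem_map, Finset.mem_range, addRightEmbedding_apply]
    exact ⟨fun hi => ⟨i - 1, by omega, by omega⟩, by rintro ⟨j, hj, rfl⟩; omega⟩
  rw [this, Finset.sum_map, Finset.sum_range]
  push_cast
  congr 1
  refine Finset.sum_congr rfl fun i _ => ?_
  simp only [addRightEmbedding_apply]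
  congr 2
  omega

theorem coeff_one : coeff 1 = 1 / 12 := by simp [coeff]

theorem coeff_two : coeff 2 = -1 / 720 := by
  rw [coeff_rec 2 (by norm_num)]
  norm_num [coeff_one]

theorem coeff_three : coeff 3 = 1 / 30240 := by
  rw [coeff_rec 3 (by norm_num)]
  norm_num [Finset.sum_Icc_succ_top, coeff_one, coeff_two]

theorem coeff_four : coeff 4 = -1 / 1209600 := by
  rw [coeff_rec 4 (by norm_num)]
  norm_num [Finset.sum_Icc_succ_top, coeff_one, coeff_two, coeff_three]

theorem coeff_five : coeff 5 = 1 / 47900160 := by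
  rw [coeff_rec 5 (by norm_num)]
  norm_num [Finset.sum_Icc_succ_top, coeff_one, coeff_two, coeff_three, coeff_four]

/-! ### The generating function `(u/2) coth(u/2)` -/

/-- The Taylor coefficients of `(u / 2) coth (u / 2) = 1 + c₁ u² + c₂ u⁴ + ⋯`. -/
def cothCoeff (n : ℕ) : ℚ :=
  if n = 0 then 1 else if Even n then coeff (n / 2) else 0

@[simp] theorem cothCoeff_zero : cothCoeff 0 = 1 := by simp [cothCoeff]

theorem cothCoeff_of_odd {n : ℕ} (hn : Odd n) : cothCoeff n = 0 := by
  rw [cothCoeff, if_neg (by rintro rfl; simp at hn), if_neg (Nat.not_even_iff_odd.2 hn)]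

theorem cothCoeff_two_mul {h : ℕ} (hh : h ≠ 0) : cothCoeff (2 * h) = coeff h := by
  simp [cothCoeff, hh]

theorem sum_range_two_mul_add_one {M : Type*} [AddCommMonoid M] (g : ℕ → M)
    (hg : ∀ i, Odd i → g i = 0) (h : ℕ) :
    ∑ i ∈ Finset.range (2 * h + 1), g i = ∑ i ∈ Finset.range (h + 1), g (2 * i) := by
  induction h with
  | zero => simp
  | succ h ih =>
    rw [Finset.sum_range_succ _ (h + 1), ← ih, show 2 * (h + 1) + 1 = 2 * h + 1 + 1 + 1 by ring,
      Finset.sum_range_succ, Finset.sum_range_succ, hg (2 * h + 1) ⟨h, rfl⟩, add_zero]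
    rfl

theorem sum_range_add_one_eq_sum_Icc {M : Type*} [AddCommMonoid M] (g : ℕ → M)
    (hg : ∀ i, Odd i → g i = 0) (k : ℕ) :
    ∑ i ∈ Finset.range (k + 1), g i = g 0 + ∑ h ∈ Finset.Icc 1 (k / 2), g (2 * h) := by
  have key : ∑ i ∈ Finset.range (k + 1), g i = ∑ i ∈ Finset.range (k / 2 + 1), g (2 * i) := by
    rcases Nat.even_or_odd' k with ⟨h, rfl | rfl⟩
    · rw [sum_range_two_mul_add_one g hg, Nat.mul_div_cancel_left _ two_pos]
    · rw [Finset.sum_range_succ, hg _ ⟨h, rfl⟩, add_zero, sum_range_two_mul_add_one g hg]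
      congr 2
      omega
  rw [key, Finset.sum_range_succ', add_comm, Finset.range_eq_Ico,
    Finset.sum_Ico_add' (fun i => g (2 * i)) 0 (k / 2) 1]
  rfl

/-- The convolution square of the sequence `cothCoeff`. -/
theorem sum_cothCoeff_mul (n : ℕ) :
    ∑ p ∈ Finset.HasAntidiagonal.antidiagonal n, cothCoeff p.1 * cothCoeff p.2 =
      (1 - n) * cothCoeff n + if n = 2 then 1 / 4 else 0 := by
  rw [Finset.Nat.sum_antidiagonal_eq_sum_range_succ fun i j => cothCoeff i * cothCoeff j]
  rcases Nat.even_or_odd' n with ⟨h, rfl | rfl⟩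
  · rcases Nat.eq_zero_or_pos h with rfl | hpos
    · simp
    rw [sum_range_two_mul_add_one, Finset.sum_range_succ, Finset.sum_range_eq_add_Ico _ hpos]
    · simp only [mul_zero, cothCoeff_zero, Nat.sub_zero, Nat.sub_self,
        cothCoeff_two_mul hpos.ne']
      have hs : ∑ i ∈ Finset.Ico 1 h, cothCoeff (2 * i) * cothCoeff (2 * h - 2 * i) =
          ∑ i ∈ Finset.Icc 1 (h - 1), coeff i * coeff (h - i) := by
        refine Finset.sum_congr (by ext; simp; omega) fun i hi => ?_
        rw [Finset.mem_Icc] at hi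
        rw [← Nat.mul_sub, cothCoeff_two_mul (by omega), cothCoeff_two_mul (by omega)]
      rw [hs]
      rcases Nat.lt_or_ge 1 h with h1 | h1
      -- The two end terms contribute `2 c_h`; the inner sum is `-(2h+1) c_h` by the recursion, for
      -- a total of `(1 - 2h) c_h`.
      · rw [if_neg (by omega), coeff_rec h h1]
        have : (2 * (h : ℚ) + 1) ≠ 0 := by positivity
        push_cast
        field_simp
        ring
      · obtain rfl : h = 1 := by omega
        norm_num [coeff_one]
    · intro i hi
      rw [cothCoeff_of_odd hi, zero_mul]
  · rw [Finset.sum_eq_zero, cothCoeff_of_odd ⟨h, rfl⟩, if_neg (by omega)]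
    · simp
    · intro i hi
      have hi := Finset.mem_range_succ_iff.1 hi
      -- When `n` is odd, one of the two indices in each product is odd.
      rcases Nat.even_or_odd i with he | ho
      · rw [cothCoeff_of_odd (n := 2 * h + 1 - i) (Nat.Odd.sub_even hi ⟨h, rfl⟩ he), mul_zero]
      · rw [cothCoeff_of_odd ho, zero_mul]

/-- The series with coefficients `cothCoeff`. -/
noncomputable def cothSeries : PowerSeries ℚ := PowerSeries.mk cothCoeff

open PowerSeries in
theorem X_mul_derivative_cothSeries :
    X * d⁄dX ℚ cothSeries = cothSeries + C (1 / 4) * X ^ 2 - cothSeries ^ 2 := by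
  ext n
  have hx : PowerSeries.coeff n (X * d⁄dX ℚ cothSeries) = n * cothCoeff n := by
    cases n with
    | zero => simp
    | succ n =>
      rw [coeff_succ_X_mul, coeff_derivative, cothSeries, coeff_mk]
      push_cast
      ring
  rw [hx, map_sub, map_add, coeff_C_mul, coeff_X_pow, pow_two, coeff_mul, cothSeries]
  simp only [coeff_mk, sum_cothCoeff_mul]
  split_ifs <;> ring

-- Since `X` divides `G`, it cancels and leaves the regular linear equation `D' = D * G'`, which
-- determines each coefficient of `D` from the earlier ones.
open PowerSeries in
theorem eq_zero_of_X_mul_derivative {D G : PowerSeries ℚ} (hD : constantCoeff D = 0)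
    (hG : constantCoeff G = 0) (h : X * d⁄dX ℚ D = D * G) : D = 0 := by
  obtain ⟨G', rfl⟩ := X_dvd_iff.2 hG
  have h' : d⁄dX ℚ D = D * G' := X_mul_cancel (by rw [h]; ring)
  ext n
  induction n using Nat.strong_induction_on with
  | _ n ih =>
    cases n with
    | zero => simpa using hD
    | succ n =>
      have := congrArg (PowerSeries.coeff n) h'
      rw [coeff_derivative, coeff_mul, Finset.sum_eq_zero] at this
      · rcases mul_eq_zero.1 this with h0 | h0
        · simpa using h0
        · exact absurd h0 (by positivity)
      · intro p hp
        rw [ih p.1 (by have := Finset.HasAntidiagonal.mem_antidiagonal.1 hp; omega)]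
        simp

open PowerSeries in
theorem cothSeries_mul_exp_sub_one :
    cothSeries * (exp ℚ - 1) = C (1 / 2) * X * (exp ℚ + 1) := by
  rw [← sub_eq_zero]
  have h2 : (2 : PowerSeries ℚ) * C (1 / 2) = 1 := by
    rw [← map_ofNat (C (R := ℚ)) 2, ← map_mul]; norm_num
  have h4 : (C (1 / 4) : PowerSeries ℚ) = C (1 / 2) * C (1 / 2) := by
    rw [← map_mul]; norm_num
  -- With `f` for `cothSeries`, the Riccati equation shows that the difference `D` of the two sides
  -- satisfies `X D' = D (1 - f + X/2)`.
  refine eq_zero_of_X_mul_derivative (G := 1 - cothSeries + C (1 / 2) * X) ?_ ?_ ?_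
  · simp [cothSeries]
  · simp [cothSeries]
  · have hc := X_mul_derivative_cothSeries
    rw [h4] at hc
    have hd : d⁄dX ℚ (cothSeries * (exp ℚ - 1) - C (1 / 2) * X * (exp ℚ + 1)) =
        d⁄dX ℚ cothSeries * (exp ℚ - 1) + cothSeries * exp ℚ -
          (C (1 / 2) * (exp ℚ + 1) + C (1 / 2) * X * exp ℚ) := by
      simp only [map_sub, map_add, Derivation.leibniz, derivative_exp, derivative_C, derivative_X,
        Derivation.map_one_eq_zero, smul_eq_mul]
      ring
    rw [hd]
    linear_combination (exp ℚ - 1) * hc + 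
      (X ^ 2 * exp ℚ * C (1 / 2) - X * exp ℚ * cothSeries) * h2

/-- This is the coefficient of `X^(n+1)` in `cothSeries_mul_exp_sub_one`; the term `m = n + 1` drops
out because `exp - 1` has no constant term. -/
theorem sum_cothCoeff_div_factorial (n : ℕ) :
    ∑ m ∈ Finset.range (n + 1), cothCoeff m / (n - m + 1).factorial =
      (1 / n.factorial + if n = 0 then 1 else 0) / 2 := by
  have h := congrArg (PowerSeries.coeff (n + 1)) cothSeries_mul_exp_sub_one
  rw [mul_assoc, PowerSeries.coeff_C_mul, PowerSeries.coeff_succ_X_mul, PowerSeries.coeff_mul,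
    Finset.Nat.sum_antidiagonal_eq_sum_range_succ fun i j =>
      PowerSeries.coeff i cothSeries * PowerSeries.coeff j (PowerSeries.exp ℚ - 1),
    Finset.sum_range_succ] at h
  simp only [map_sub, map_add, PowerSeries.coeff_exp, PowerSeries.coeff_one, cothSeries,
    PowerSeries.coeff_mk, Nat.sub_self] at h
  have h0 : ∑ m ∈ Finset.range (n + 1), cothCoeff m / (n - m + 1).factorial =
      ∑ m ∈ Finset.range (n + 1), cothCoeff m *
        (algebraMap ℚ ℚ (1 / (n + 1 - m).factorial) - if n + 1 - m = 0 then 1 else 0) := by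
    refine Finset.sum_congr rfl fun m hm => ?_
    have hm := Finset.mem_range_succ_iff.1 hm
    rw [if_neg (by omega), show n + 1 - m = n - m + 1 by omega]
    simp [div_eq_mul_inv]
  rw [h0]
  simp at h ⊢
  rw [h]
  ring

/-! ### Polarization -/

open Finset in
/-- A symmetric multilinear map is determined by its values on the diagonal. -/
theorem eq_zero_of_symmetric_of_diagonal {K M N : Type*} [Field K] [CharZero K] [AddCommGroup M]
    [Module K M] [AddCommGroup N] [Module K N] {k : ℕ} (f : MultilinearMap K (fun _ : Fin k => M) N)
    (hsymm : ∀ (σ : Equiv.Perm (Fin k)) (b : Fin k → M), f (fun i => b (σ i)) = f b)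
    (hdiag : ∀ B : M, f (fun _ => B) = 0) (b : Fin k → M) : f b = 0 := by
  -- Expand `f` on the diagonal at `∑ j ∈ S, b j`. The alternating sum over `S` then isolates the
  -- surjective index maps.
  have hexp (S : Finset (Fin k)) :
      ∑ r : Fin k → Fin k, (if ∀ i, r i ∈ S then f (fun i => b (r i)) else 0) = 0 := by
    refine Eq.trans ?_ (hdiag (∑ j ∈ S, b j))
    rw [f.map_sum_finset (fun _ => b) (fun _ => S), ← sum_filter]
    refine sum_congr ?_ fun _ _ => rfl
    ext r
    simp [Fintype.mem_piFinset]
  have hsum : ∑ r : Fin k → Fin k, (∑ S : Finset (Fin k),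
      if ∀ i, r i ∈ S then (-1 : ℤ) ^ (#Sᶜ) else 0) • f (fun i => b (r i)) = 0 := by
    simp_rw [sum_smul, ite_smul, zero_smul]
    rw [sum_comm]
    refine sum_eq_zero fun S _ => ?_
    refine Eq.trans ?_ (((congrArg (((-1 : ℤ) ^ (#Sᶜ)) • ·) (hexp S))).trans (smul_zero _))
    simp only [smul_sum]
    refine sum_congr rfl fun r _ => ?_
    split_ifs <;> simp
  have hsign (r : Fin k → Fin k) : (∑ S : Finset (Fin k),
      if ∀ i, r i ∈ S then (-1 : ℤ) ^ (#Sᶜ) else 0) =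
        if Function.Bijective r then 1 else 0 := by
    rw [← sum_filter]
    -- After complementation, `S` runs over all subsets of the complement of the image of `r`, so
    -- the signs cancel unless `r` is onto.
    have hfil : (univ.filter fun S : Finset (Fin k) => ∀ i, r i ∈ Sᶜ) =
        ((univ.image r)ᶜ).powerset := by
      ext S
      simp only [mem_filter_univ, mem_powerset, mem_compl, subset_iff, mem_image, mem_univ,
        true_and, not_exists]
      exact ⟨fun h x hx i hi => h i (hi ▸ hx), fun h i hi => h hi i rfl⟩
    have hcompl : ∑ S : Finset (Fin k) with ∀ i, r i ∈ S, (-1 : ℤ) ^ (#Sᶜ) =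
        ∑ S : Finset (Fin k) with ∀ i, r i ∈ Sᶜ, (-1 : ℤ) ^ (#S) :=
      sum_nbij' compl compl (by simp) (by simp) (by simp) (by simp) (by simp)
    rw [hcompl, hfil, sum_powerset_neg_one_pow_card]
    congr 1
    rw [compl_eq_empty_iff, ← Finset.coe_eq_univ, coe_image, coe_univ, Set.image_univ,
      Set.range_eq_univ, eq_iff_iff]
    exact Finite.surjective_iff_bijective
  simp_rw [hsign, ite_smul, one_smul, zero_smul] at hsum
  rw [← sum_filter, ← sum_subtype_eq_sum_filter] at hsum
  have hperm : ∑ σ : Equiv.Perm (Fin k), f (fun i => b (σ i)) = 0 := by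
    rw [← hsum]
    refine sum_bij (fun σ _ => ⟨σ, by simp⟩) (by simp) ?_ ?_ (by simp)
    · intro σ _ τ _ h
      exact DFunLike.coe_injective (Subtype.ext_iff.1 h)
    · rintro ⟨r, hr⟩ h
      exact ⟨Equiv.ofBijective r hr, by simp, rfl⟩
  simp_rw [hsymm] at hperm
  rw [sum_const, card_univ, Fintype.card_perm, Fintype.card_fin, ← Nat.cast_smul_eq_nsmul K] at hperm
  exact (smul_eq_zero.1 hperm).resolve_left (by exact_mod_cast k.factorial_ne_zero)

/-! ### The polynomial identity in two commuting variables -/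

-- Formally both sides are `((x + u)^(n+1) - x^(n+1)) / u`; induction avoids dividing by `u`, which
-- may be a zero divisor.
open Finset in
theorem sum_pow_mul_add_pow {E : Type*} [CommRing E] (x u : E) (n : ℕ) :
    ∑ p ∈ range (n + 1), x ^ p * (x + u) ^ (n - p) =
      ∑ j ∈ range (n + 1), ((n + 1).choose (j + 1) : E) * (u ^ j * x ^ (n - j)) := by
  induction n with
  | zero => simp
  | succ n ih =>
    have h1 : ∑ p ∈ range (n + 1 + 1), x ^ p * (x + u) ^ (n + 1 - p) =
        x * ∑ p ∈ range (n + 1), x ^ p * (x + u) ^ (n - p) + (x + u) ^ (n + 1) := by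
      rw [sum_range_succ', mul_sum]
      congr 1
      · refine sum_congr rfl fun p _ => ?_
        rw [Nat.add_sub_add_right, pow_succ]
        ring
      · simp
    have h2 : x * ∑ j ∈ range (n + 1), ((n + 1).choose (j + 1) : E) * (u ^ j * x ^ (n - j)) =
        ∑ j ∈ range (n + 1 + 1), ((n + 1).choose (j + 1) : E) * (u ^ j * x ^ (n + 1 - j)) := by
      rw [sum_range_succ _ (n + 1), Nat.choose_eq_zero_of_lt (Nat.lt_succ_self _), mul_sum]
      simp only [Nat.cast_zero, zero_mul, add_zero]
      refine sum_congr rfl fun j hj => ?_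
      rw [show n + 1 - j = n - j + 1 by have := mem_range.1 hj; omega, pow_succ]
      ring
    rw [h1, ih, h2, add_comm x u, add_pow, ← sum_add_distrib]
    refine sum_congr rfl fun j _ => ?_
    rw [Nat.choose_succ_succ (n + 1) j]
    push_cast
    ring

theorem descFactorial_mul_choose_div {k m j : ℕ} (h : m + j ≤ k) :
    ((k.descFactorial m : ℚ) / (k - m + 1 : ℕ)) * ((k - m + 1).choose (j + 1) : ℚ) =
      (k.factorial / (k - (m + j)).factorial : ℚ) / (j + 1).factorial := by
  obtain ⟨l, rfl⟩ := Nat.exists_eq_add_of_le h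
  have h1 := Nat.factorial_mul_descFactorial (show m ≤ m + j + l by omega)
  have h2 := Nat.choose_mul_factorial_mul_factorial (show j + 1 ≤ j + l + 1 by omega)
  rw [show m + j + l - m = j + l by omega] at h1 ⊢
  rw [show j + l + 1 - (j + 1) = l by omega, Nat.factorial_succ (j + l)] at h2
  rw [show m + j + l - (m + j) = l by omega, ← h1]
  have h2' : ((j + l + 1).choose (j + 1) : ℚ) =
      ((j + l + 1 : ℕ) * (j + l).factorial : ℚ) / ((j + 1).factorial * l.factorial) := by
    rw [eq_div_iff (by positivity), ← mul_assoc]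
    exact_mod_cast h2
  rw [h2']
  push_cast
  have : ((j : ℚ) + l + 1) ≠ 0 := by positivity
  field_simp

open Finset in
theorem half_add_pow_eq {E : Type*} [CommRing E] [Algebra ℚ E] (x y : E) (k : ℕ) :
    (1 / 2 : ℚ) • (x ^ k + y ^ k) = ∑ m ∈ range (k + 1),
      (cothCoeff m * (k.descFactorial m / (k - m + 1 : ℕ))) •
        ((∑ p ∈ range (k - m + 1), x ^ p * y ^ (k - m - p)) * (y - x) ^ m) := by
  obtain ⟨u, rfl⟩ : ∃ u, y = x + u := ⟨y - x, by ring⟩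
  simp_rw [sum_pow_mul_add_pow, add_sub_cancel_left, sum_mul, smul_sum]
  have h1 : ∀ m ∈ range (k + 1), ∑ j ∈ range (k - m + 1),
      (cothCoeff m * (k.descFactorial m / (k - m + 1 : ℕ))) •
        (((k - m + 1).choose (j + 1) : E) * (u ^ j * x ^ (k - m - j)) * u ^ m) =
      ∑ j ∈ range (k + 1 - m), (k.factorial / (k - (m + j)).factorial *
        (cothCoeff m / (j + 1).factorial) : ℚ) • (u ^ (m + j) * x ^ (k - (m + j))) := by
    intro m hm
    have hm := mem_range_succ_iff.1 hm
    refine sum_congr (by congr 1; omega) fun j hj => ?_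
    have hj := mem_range.1 hj
    rw [show (k.factorial / (k - (m + j)).factorial * (cothCoeff m / (j + 1).factorial) : ℚ) =
      cothCoeff m * ((k.factorial / (k - (m + j)).factorial) / (j + 1).factorial) by ring,
      ← descFactorial_mul_choose_div (by omega), ← mul_assoc (cothCoeff m),
      mul_smul _ ((k - m + 1).choose (j + 1) : ℚ) (_ : E),
      Nat.cast_smul_eq_nsmul, nsmul_eq_mul, Nat.sub_sub]
    congr 1
    ring
  -- Regroup by the total power `M = m + j` of `u`.
  rw [sum_congr rfl h1, ← sum_range_diag_flip]
  have h2 : ∀ M ∈ range (k + 1), ∑ m ∈ range (M + 1),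
      (k.factorial / (k - (m + (M - m))).factorial *
        (cothCoeff m / (M - m + 1).factorial) : ℚ) •
          (u ^ (m + (M - m)) * x ^ (k - (m + (M - m)))) =
      (1 / 2 : ℚ) • (u ^ M * x ^ (k - M) * (k.choose M : E) +
        if M = 0 then x ^ k else 0) := by
    intro M hM
    have hM := mem_range_succ_iff.1 hM
    have h3 : ∀ m ∈ range (M + 1), (k.factorial / (k - (m + (M - m))).factorial *
        (cothCoeff m / (M - m + 1).factorial) : ℚ) •
          (u ^ (m + (M - m)) * x ^ (k - (m + (M - m)))) =
        (k.factorial / (k - M).factorial * (cothCoeff m / (M - m + 1).factorial) : ℚ) •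
          (u ^ M * x ^ (k - M)) := by
      intro m hm
      rw [Nat.add_sub_cancel' (mem_range_succ_iff.1 hm)]
    rw [sum_congr rfl h3, ← sum_smul, ← mul_sum, sum_cothCoeff_div_factorial]
    have h4 : (k.factorial / (k - M).factorial : ℚ) * (1 / M.factorial) = k.choose M := by
      rw [Nat.cast_choose ℚ hM]
      field_simp
    rw [mul_comm _ (k.choose M : E), ← nsmul_eq_mul, ← Nat.cast_smul_eq_nsmul ℚ, ← h4]
    -- The extra `x ^ k` at `M = 0` is the summand `x ^ k` of the left side; the binomial terms make
    -- up `(x + u) ^ k`.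
    rcases eq_or_ne M 0 with rfl | h0
    · have : (k.factorial : ℚ) ≠ 0 := by positivity
      simp [div_self this]
      module
    · simp only [h0, if_false, add_zero, smul_smul]
      congr 1
      ring
  rw [sum_congr rfl h2, ← smul_sum, sum_add_distrib, ← add_pow, sum_ite_eq' (range (k + 1)) 0]
  simp [add_comm]

open Finset IsMulCommutative in
theorem half_add_pow_eq_of_commute_rat {E : Type*} [Ring E] [Algebra ℚ E] {x y : E} (h : Commute x y)
    (k : ℕ) : (1 / 2 : ℚ) • (x ^ k + y ^ k) = ∑ m ∈ range (k + 1),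
      (cothCoeff m * (k.descFactorial m / (k - m + 1 : ℕ))) •
        ((∑ p ∈ range (k - m + 1), x ^ p * y ^ (k - m - p)) * (y - x) ^ m) := by
  -- Commuting elements generate a commutative subalgebra, where the previous identity applies.
  have := Algebra.isMulCommutative_adjoin ℚ (s := {x, y}) (by
    rintro a (rfl | rfl) b (rfl | rfl)
    exacts [rfl, h, h.symm, rfl])
  let x' : Algebra.adjoin ℚ {x, y} := ⟨x, Algebra.subset_adjoin (by simp)⟩
  let y' : Algebra.adjoin ℚ {x, y} := ⟨y, Algebra.subset_adjoin (by simp)⟩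
  have := congrArg (Algebra.adjoin ℚ {x, y}).val (SymProd.half_add_pow_eq x' y' k)
  simpa [x', y', map_sum] using this

open Finset in
theorem half_add_pow_eq_of_commute (K : Type*) {E : Type*} [Field K] [CharZero K] [Ring E]
    [Algebra K E] {x y : E} (h : Commute x y) (k : ℕ) :
    (1 / 2 : K) • (x ^ k + y ^ k) = ∑ m ∈ range (k + 1),
      ((cothCoeff m : K) * (k.descFactorial m / (k - m + 1 : ℕ))) •
        ((∑ p ∈ range (k - m + 1), x ^ p * y ^ (k - m - p)) * (y - x) ^ m) := by
  let _ : Algebra ℚ E := Algebra.compHom E (algebraMap ℚ K)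
  have hs (q : ℚ) (e : E) : q • e = (q : K) • e := rfl
  have := half_add_pow_eq_of_commute_rat h k
  simp_rw [hs] at this
  push_cast at this ⊢
  exact this

/-! ### Symmetry of the sums and linearity of iterated commutators -/

section NonUnital

variable (K : Type*) {A : Type*} [Field K] [NonUnitalRing A] [Module K A]

theorem sym_comp_perm {n : ℕ} (v : Fin n → A) (σ : Equiv.Perm (Fin n)) :
    sym K (fun i => v (σ i)) = sym K v := by
  rw [sym, sym]
  congr 1
  exact Equiv.sum_comp (Equiv.mulLeft σ) fun π => listProd (List.ofFn fun i => v (π i))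

theorem sym_cons_comp_perm {n : ℕ} (a : A) (v : Fin n → A) (σ : Equiv.Perm (Fin n)) :
    sym K (Fin.cons a fun i => v (σ i) : Fin (n + 1) → A) = sym K (Fin.cons a v : Fin (n + 1) → A) := by
  rw [← sym_comp_perm K (Fin.cons a v : Fin (n + 1) → A) (Equiv.Perm.decomposeFin.symm (0, σ))]
  congr 1
  funext i
  refine Fin.cases ?_ (fun i => ?_) i <;> simp

theorem range_restIdx {m k : ℕ} (i : Fin m ↪ Fin k) :
    Set.range (restIdx i) = (Set.range i)ᶜ := by
  rw [restIdx, Finset.range_orderEmbOfFin]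
  simp

/-- `σ` carries the complement of one tuple onto that of the other but need not preserve order; the
discrepancy `τ` is harmless inside `sym`. -/
theorem exists_perm_restIdx {m k : ℕ} (i : Fin m ↪ Fin k) (σ : Equiv.Perm (Fin k)) :
    ∃ τ : Equiv.Perm (Fin (k - m)),
      ∀ t, σ (restIdx i t) = restIdx (i.trans σ.toEmbedding) (τ t) := by
  have hr : Set.range (fun t => σ (restIdx i t)) =
      Set.range (restIdx (i.trans σ.toEmbedding)) := by
    rw [range_restIdx, Set.range_comp' σ, range_restIdx, Set.image_compl_eq σ.bijective,
      Function.Embedding.coe_trans, Set.range_comp]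
    rfl
  have h (t) : ∃ s, restIdx (i.trans σ.toEmbedding) s = σ (restIdx i t) := by
    rw [← Set.mem_range, ← hr]
    exact ⟨t, rfl⟩
  choose f hf using h
  have hinj : Function.Injective f := fun s t hst =>
    (restIdx i).injective (σ.injective (by rw [← hf, ← hf, hst]))
  exact ⟨Equiv.ofBijective f (Finite.injective_iff_bijective.1 hinj), fun t => (hf t).symm⟩

theorem commSum_comp_perm {k : ℕ} (h : ℕ) (a : A) (b : Fin k → A) (σ : Equiv.Perm (Fin k)) :
    commSum K h a (fun i => b (σ i)) = commSum K h a b := by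
  rw [commSum, commSum]
  refine Fintype.sum_equiv (Equiv.embeddingCongr (Equiv.refl (Fin (2 * h))) σ) _ _ fun i => ?_
  have he : Equiv.embeddingCongr (Equiv.refl (Fin (2 * h))) σ i = i.trans σ.toEmbedding := by
    ext; simp
  obtain ⟨τ, hτ⟩ := exists_perm_restIdx i σ
  have hb : (fun t => b (σ (restIdx i t))) =
      fun t => b (restIdx (i.trans σ.toEmbedding) (τ t)) := funext fun t => congrArg b (hτ t)
  rw [he, hb, sym_cons_comp_perm K _ (fun t => b (restIdx (i.trans σ.toEmbedding) t)) τ]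
  rfl

theorem iterComm_zero (a : A) (b : Fin 0 → A) : iterComm a b = a := by simp [iterComm]

theorem iterComm_succ (a : A) {m : ℕ} (b : Fin (m + 1) → A) :
    iterComm a b = iterComm ⁅a, b 0⁆ fun i => b i.succ := by
  simp [iterComm, List.ofFn_succ]

variable [IsScalarTower K A A] [SMulCommClass K A A]

theorem isLinearMap_lie_left (x : A) : IsLinearMap K fun a : A => ⁅a, x⁆ where
  map_add a b := by simp only [Ring.lie_def, add_mul, mul_add]; abel
  map_smul c a := by simp only [Ring.lie_def, smul_mul_assoc, mul_smul_comm, smul_sub]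

theorem isLinearMap_lie_right (a : A) : IsLinearMap K fun x : A => ⁅a, x⁆ where
  map_add a b := by simp only [Ring.lie_def, add_mul, mul_add]; abel
  map_smul c a := by simp only [Ring.lie_def, smul_mul_assoc, mul_smul_comm, smul_sub]

theorem isLinearMap_iterComm_left {m : ℕ} (b : Fin m → A) :
    IsLinearMap K fun a => iterComm a b := by
  induction m with
  | zero => simpa only [iterComm_zero] using IsLinearMap.mk (fun _ _ => rfl) fun _ _ => rfl
  | succ m ih =>
    simp only [iterComm_succ]
    exact (((ih fun i => b i.succ).mk' _).comp ((isLinearMap_lie_left K (b 0)).mk' _)).isLinear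

theorem isLinearMap_iterComm_update {m : ℕ} (a : A) (b : Fin m → A) (j : Fin m) :
    IsLinearMap K fun x => iterComm a (Function.update b j x) := by
  induction m generalizing a with
  | zero => exact j.elim0
  | succ m ih =>
    simp only [iterComm_succ]
    refine Fin.cases ?_ (fun j => ?_) j
    · convert (((isLinearMap_iterComm_left K fun i => b i.succ).mk' _).comp
        ((isLinearMap_lie_right K a).mk' _)).isLinear using 2
      simp [Fin.succ_ne_zero]
    · have (x : A) : (fun i : Fin m => Function.update b j.succ x i.succ) =
          Function.update (fun i => b i.succ) j x :=
        Function.update_comp_eq_of_injective b (Fin.succ_injective m) j x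
      simpa [this, (Fin.succ_ne_zero j).symm] using ih ⁅a, b 0⁆ (fun i => b i.succ) j

end NonUnital

/-! ### The general formula in unital algebras -/

section Unital

variable (K : Type*) {R : Type*} [Field K] [Ring R] [Algebra K R]

variable (R) in
/-- The symmetrized product as a multilinear map. -/
noncomputable def symMultilinear (n : ℕ) : MultilinearMap K (fun _ : Fin n => R) R :=
  (n.factorial : K)⁻¹ • ∑ π : Equiv.Perm (Fin n),
    (MultilinearMap.mkPiAlgebraFin K n R).domDomCongr π

/-- `n = 0` is excluded because `listProd` gives the empty product the value `0`, not `1`. -/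
theorem sym_eq_symMultilinear {n : ℕ} (hn : n ≠ 0) (v : Fin n → R) :
    sym K v = symMultilinear K R n v := by
  rw [sym, symMultilinear, smul_apply, sum_apply]
  congr 1
  refine Finset.sum_congr rfl fun π _ => ?_
  rw [listProd_eq_prod _ (by simpa using hn)]
  rfl

theorem isLinearMap_sym_cons_left {n : ℕ} (v : Fin n → R) :
    IsLinearMap K fun a => sym K (Fin.cons a v : Fin (n + 1) → R) := by
  have := ((symMultilinear K R (n + 1)).toLinearMap (Fin.cons 0 v) 0).isLinear
  convert this using 2
  simp [sym_eq_symMultilinear]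

theorem isLinearMap_sym_cons_update {n : ℕ} (a : R) (v : Fin n → R) (j : Fin n) :
    IsLinearMap K fun x => sym K (Fin.cons a (Function.update v j x) : Fin (n + 1) → R) := by
  have := ((symMultilinear K R (n + 1)).toLinearMap (Fin.cons a v) j.succ).isLinear
  convert this using 2
  simp [sym_eq_symMultilinear, Fin.cons_update]

/-- Each index `j` occurs exactly once, either in the commutator or among the remaining factors, and
each place is linear. -/
theorem isLinearMap_commTerm_update {m k : ℕ} (a : R) (b : Fin k → R) (i : Fin m ↪ Fin k)
    (j : Fin k) : IsLinearMap K fun x =>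
      sym K (Fin.cons (iterComm a fun s => Function.update b j x (i s))
        fun t => Function.update b j x (restIdx i t) : Fin (k - m + 1) → R) := by
  by_cases hj : j ∈ Set.range i
  · obtain ⟨s, rfl⟩ := hj
    have h1 (x : R) : (fun t => Function.update b (i s) x (restIdx i t)) =
        fun t => b (restIdx i t) :=
      Function.update_comp_eq_of_forall_ne b x fun t ht => by
        have : restIdx i t ∈ (Set.range i)ᶜ := range_restIdx i ▸ ⟨t, rfl⟩
        exact this ⟨s, ht.symm⟩
    have h2 (x : R) : (fun t => Function.update b (i s) x (i t)) =
        Function.update (fun t => b (i t)) s x :=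
      Function.update_comp_eq_of_injective b i.injective s x
    simp only [h1, h2]
    exact (((isLinearMap_sym_cons_left K fun t => b (restIdx i t)).mk' _).comp
      ((isLinearMap_iterComm_update K a (fun t => b (i t)) s).mk' _)).isLinear
  · have h1 (x : R) : (fun t => Function.update b j x (i t)) = fun t => b (i t) :=
      Function.update_comp_eq_of_forall_ne b x fun t ht => hj ⟨t, ht⟩
    obtain ⟨t, rfl⟩ : j ∈ Set.range (restIdx i) := by rwa [range_restIdx]
    have h2 (x : R) : (fun s => Function.update b (restIdx i t) x (restIdx i s)) =
        Function.update (fun s => b (restIdx i s)) t x :=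
      Function.update_comp_eq_of_injective b (restIdx i).injective t x
    simp only [h1, h2]
    exact isLinearMap_sym_cons_update K _ _ _

/-- The sums of iterated commutators as multilinear maps. -/
noncomputable def commSumMultilinear (k h : ℕ) (a : R) :
    MultilinearMap K (fun _ : Fin k => R) R :=
  ∑ i : Fin (2 * h) ↪ Fin k, MultilinearMap.mk'
    (fun b => sym K (Fin.cons (iterComm a fun s => b (i s)) fun t => b (restIdx i t) :
      Fin (k - 2 * h + 1) → R))
    (fun b j => (isLinearMap_commTerm_update K a b i j).map_add)
    (fun b j => (isLinearMap_commTerm_update K a b i j).map_smul)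

theorem commSum_eq_commSumMultilinear {k : ℕ} (h : ℕ) (a : R) (b : Fin k → R) :
    commSum K h a b = commSumMultilinear K k h a b := by
  rw [commSum, commSumMultilinear, sum_apply]
  rfl

/-- The symmetrized product with a fixed first factor as a multilinear map. -/
noncomputable def symConsMultilinear (k : ℕ) (a : R) : MultilinearMap K (fun _ : Fin k => R) R :=
  MultilinearMap.mk' (fun b => sym K (Fin.cons a b : Fin (k + 1) → R))
    (fun b j => (isLinearMap_sym_cons_update K a b j).map_add)
    (fun b j => (isLinearMap_sym_cons_update K a b j).map_smul)

theorem sym_const [CharZero K] {n : ℕ} (hn : n ≠ 0) (B : R) : sym K (fun _ : Fin n => B) = B ^ n := by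
  rw [sym, Finset.sum_const, Finset.card_univ, Fintype.card_perm, Fintype.card_fin,
    listProd_eq_prod _ (by simpa using hn), ← Nat.cast_smul_eq_nsmul K, smul_smul,
    inv_mul_cancel₀ (by exact_mod_cast n.factorial_ne_zero), one_smul]
  simp

theorem prod_ofFn_update_const {n : ℕ} (a B : R) (p : Fin (n + 1)) :
    (List.ofFn (Function.update (fun _ => B) p a)).prod = B ^ (p : ℕ) * a * B ^ (n - p) := by
  induction n with
  | zero => simp [Fin.fin_one_eq_zero p]
  | succ n ih =>
    rw [List.ofFn_succ, List.prod_cons]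
    refine Fin.cases ?_ (fun p => ?_) p
    · simp [Fin.succ_ne_zero, pow_succ']
    · have : (fun i : Fin (n + 1) => Function.update (fun _ : Fin (n + 2) => B) p.succ a i.succ) =
          Function.update (fun _ => B) p a :=
        Function.update_comp_eq_of_injective _ (Fin.succ_injective _) p a
      rw [this, ih, Function.update_of_ne (Fin.succ_ne_zero p).symm]
      simp [pow_succ', mul_assoc]

theorem sym_cons_const [CharZero K] (n : ℕ) (a B : R) :
    sym K (Fin.cons a fun _ => B : Fin (n + 1) → R) =
      ((n + 1 : ℕ) : K)⁻¹ • ∑ p ∈ Finset.range (n + 1), B ^ p * a * B ^ (n - p) := by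
  -- `decomposeFin.symm (p, e)` sends `0` to `p`, so the word of its inverse has `a` in position
  -- `p`; each `p` thus arises from `n!` permutations.
  have key (p : Fin (n + 1)) (e : Equiv.Perm (Fin n)) :
      listProd (List.ofFn fun i => (Fin.cons a fun _ => B : Fin (n + 1) → R)
        ((Equiv.Perm.decomposeFin.symm (p, e))⁻¹ i)) = B ^ (p : ℕ) * a * B ^ (n - p) := by
    rw [listProd_eq_prod _ (by simp), ← prod_ofFn_update_const]
    congr 2
    funext i
    obtain ⟨i, rfl⟩ := (Equiv.Perm.decomposeFin.symm (p, e)).surjective i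
    rw [Equiv.Perm.inv_def, Equiv.symm_apply_apply]
    refine Fin.cases ?_ (fun j => ?_) i
    · simp
    · have : Equiv.Perm.decomposeFin.symm (p, e) j.succ ≠ p := fun h =>
        Fin.succ_ne_zero j ((Equiv.Perm.decomposeFin.symm (p, e)).injective (by rw [h]; simp))
      rw [Function.update_of_ne this, Fin.cons_succ]
  rw [sym, ← Equiv.sum_comp (Equiv.inv (Equiv.Perm (Fin (n + 1)))),
    ← Equiv.Perm.decomposeFin.symm.sum_comp, Fintype.sum_prod_type]
  simp only [Equiv.inv_apply, key]
  rw [Finset.sum_range fun p => B ^ p * a * B ^ (n - p)]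
  simp only [Finset.sum_const, Finset.card_univ, Fintype.card_perm, Fintype.card_fin]
  rw [← Finset.smul_sum, ← Nat.cast_smul_eq_nsmul K, smul_smul, Nat.factorial_succ]
  congr 1
  have : (n.factorial : K) ≠ 0 := by exact_mod_cast n.factorial_ne_zero
  have : ((n + 1 : ℕ) : K) ≠ 0 := by exact_mod_cast n.succ_ne_zero
  push_cast at this ⊢
  field_simp

theorem iterComm_const (m : ℕ) (a B : R) :
    iterComm a (fun _ : Fin m => B) =
      ((LinearMap.mulRight K B - LinearMap.mulLeft K B) ^ m : Module.End K R) a := by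
  induction m generalizing a with
  | zero => simp [iterComm_zero]
  | succ m ih => rw [iterComm_succ, ih, pow_succ]; simp [Ring.lie_def]

theorem commSum_const [CharZero K] (k h : ℕ) (a B : R) :
    commSum K h a (fun _ : Fin k => B) =
      ((k.descFactorial (2 * h) : K) / (k - 2 * h + 1 : ℕ)) •
        ∑ p ∈ Finset.range (k - 2 * h + 1),
          B ^ p * iterComm a (fun _ : Fin (2 * h) => B) * B ^ (k - 2 * h - p) := by
  rw [commSum, Finset.sum_const, Finset.card_univ, Fintype.card_embedding_eq, Fintype.card_fin,
    Fintype.card_fin, sym_cons_const, ← Nat.cast_smul_eq_nsmul K, smul_smul, div_eq_mul_inv]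

theorem diamond_sym_const [CharZero K] {k : ℕ} (hk : k ≠ 0) (a B : R) :
    diamond K a (sym K fun _ : Fin k => B) = sym K (Fin.cons a fun _ => B : Fin (k + 1) → R) +
      ∑ h ∈ Finset.Icc 1 (k / 2), (coeff h : K) • commSum K h a (fun _ : Fin k => B) := by
  have hcomm : Commute (LinearMap.mulLeft K B) (LinearMap.mulRight K B) :=
    LinearMap.commute_mulLeft_right B B
  have key := LinearMap.congr_fun (half_add_pow_eq_of_commute K hcomm k) a
  rw [sum_range_add_one_eq_sum_Icc _ (fun m hm => by simp [cothCoeff_of_odd hm])] at key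
  have hT (n m : ℕ) : ((∑ p ∈ Finset.range (n + 1), LinearMap.mulLeft K B ^ p *
      LinearMap.mulRight K B ^ (n - p)) *
        (LinearMap.mulRight K B - LinearMap.mulLeft K B) ^ m : Module.End K R) a =
      ∑ p ∈ Finset.range (n + 1), B ^ p * iterComm a (fun _ : Fin m => B) * B ^ (n - p) := by
    rw [iterComm_const K, Module.End.mul_apply, LinearMap.sum_apply]
    refine Finset.sum_congr rfl fun p _ => ?_
    rw [Module.End.mul_apply, LinearMap.pow_mulLeft, LinearMap.pow_mulRight,
      LinearMap.mulLeft_apply, LinearMap.mulRight_apply, mul_assoc]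
  rw [LinearMap.add_apply, LinearMap.sum_apply] at key
  simp only [LinearMap.smul_apply, hT] at key
  rw [sym_const K hk, sym_cons_const, diamond]
  convert key using 1
  · simp [LinearMap.pow_mulLeft, LinearMap.pow_mulRight, add_comm]
  · congr 1
    · simp [iterComm_zero]
    · refine Finset.sum_congr rfl fun h hh => ?_
      rw [commSum_const, smul_smul, cothCoeff_two_mul (by have := Finset.mem_Icc.1 hh; omega)]

theorem diamond_sym [CharZero K] {k : ℕ} (hk : k ≠ 0) (a : R) (b : Fin k → R) :
    diamond K a (sym K b) = sym K (Fin.cons a b : Fin (k + 1) → R) +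
      ∑ h ∈ Finset.Icc 1 (k / 2), (coeff h : K) • commSum K h a b := by
  let f : MultilinearMap K (fun _ : Fin k => R) R :=
    ((1 / 2 : K) • (LinearMap.mulLeft K a + LinearMap.mulRight K a)).compMultilinearMap
      (symMultilinear K R k) - (symConsMultilinear K k a +
        ∑ h ∈ Finset.Icc 1 (k / 2), (coeff h : K) • commSumMultilinear K k h a)
  have hf (b : Fin k → R) : f b = diamond K a (sym K b) -
      (sym K (Fin.cons a b : Fin (k + 1) → R) +
        ∑ h ∈ Finset.Icc 1 (k / 2), (coeff h : K) • commSum K h a b) := by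
    simp only [f, commSum_eq_commSumMultilinear, sym_eq_symMultilinear K hk, diamond,
      sub_apply, add_apply, sum_apply,
      smul_apply, LinearMap.compMultilinearMap_apply]
    rfl
  rw [← sub_eq_zero, ← hf]
  refine eq_zero_of_symmetric_of_diagonal f (fun σ b => ?_) (fun B => ?_) b
  · simp only [hf, sym_comp_perm, sym_cons_comp_perm, commSum_comp_perm]
  · rw [hf, diamond_sym_const K hk, sub_self]

end Unital

/-! ### Compatibility with algebra homomorphisms -/

section Transfer

variable (K : Type*) {A R : Type*} [Field K] [NonUnitalRing A] [Module K A] [NonUnitalRing R]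
  [Module K R] (φ : A →ₙₐ[K] R)

theorem map_listProd (l : List A) : φ (listProd l) = listProd (l.map φ) := by
  cases l with
  | nil => simp [listProd]
  | cons a l =>
    simp only [listProd, List.map_cons]
    induction l generalizing a with
    | nil => rfl
    | cons b l ih => simp [ih]

theorem map_sym {n : ℕ} (v : Fin n → A) : φ (sym K v) = sym K fun i => φ (v i) := by
  simp only [sym, map_smul, map_sum, map_listProd, List.map_ofFn]
  rfl

theorem map_diamond (a b : A) : φ (diamond K a b) = diamond K (φ a) (φ b) := by
  simp [diamond]

theorem map_iterComm (a : A) {m : ℕ} (b : Fin m → A) :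
    φ (iterComm a b) = iterComm (φ a) fun i => φ (b i) := by
  induction m generalizing a with
  | zero => simp [iterComm_zero]
  | succ m ih => simp [iterComm_succ, ih, Ring.lie_def]

theorem map_cons_apply {n : ℕ} (a : A) (v : Fin n → A) :
    (fun i => φ ((Fin.cons a v : Fin (n + 1) → A) i)) = Fin.cons (φ a) fun i => φ (v i) :=
  Fin.comp_cons φ a v

theorem map_commSum {k : ℕ} (h : ℕ) (a : A) (b : Fin k → A) :
    φ (commSum K h a b) = commSum K h (φ a) fun i => φ (b i) := by
  simp only [commSum, map_sum, map_sym, map_cons_apply, map_iterComm]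

end Transfer

/-! ### Two and three factors by explicit expansion -/

section Expansion

variable (K : Type*) {A : Type*} [Field K] [NonUnitalRing A] [Module K A]

theorem perm_fin_three_values :
    (Finset.univ : Finset (Equiv.Perm (Fin 3))).val.map (fun π => (π 0, π 1, π 2)) =
      {(0, 1, 2), (0, 2, 1), (1, 0, 2), (1, 2, 0), (2, 0, 1), (2, 1, 0)} := by
  decide

theorem sym_three (a b c : A) : sym K ![a, b, c] =
    (1 / 6 : K) • (a * b * c + a * c * b + b * a * c + b * c * a + c * a * b + c * b * a) := by
  have hf : ((Nat.factorial 3 : ℕ) : K)⁻¹ = 1 / 6 := by norm_num [Nat.factorial]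
  have hs := congrArg (fun s => (s.map fun q : Fin 3 × Fin 3 × Fin 3 =>
    ![a, b, c] q.1 * ![a, b, c] q.2.1 * ![a, b, c] q.2.2).sum) perm_fin_three_values
  rw [sym, hf]
  congr 1
  refine Eq.trans ?_ (hs.trans ?_)
  · rw [Multiset.map_map]
    rfl
  · simp only [Multiset.insert_eq_cons, Multiset.map_cons, Multiset.map_singleton,
      Multiset.sum_cons, Multiset.sum_singleton]
    simp only [Matrix.cons_val]
    abel

theorem perm_fin_four_values :
    (Finset.univ : Finset (Equiv.Perm (Fin 4))).val.map (fun π => (π 0, π 1, π 2, π 3)) =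
      {(0, 1, 2, 3), (0, 1, 3, 2), (0, 2, 1, 3), (0, 2, 3, 1), (0, 3, 1, 2), (0, 3, 2, 1),
       (1, 0, 2, 3), (1, 0, 3, 2), (1, 2, 0, 3), (1, 2, 3, 0), (1, 3, 0, 2), (1, 3, 2, 0),
       (2, 0, 1, 3), (2, 0, 3, 1), (2, 1, 0, 3), (2, 1, 3, 0), (2, 3, 0, 1), (2, 3, 1, 0),
       (3, 0, 1, 2), (3, 0, 2, 1), (3, 1, 0, 2), (3, 1, 2, 0), (3, 2, 0, 1), (3, 2, 1, 0)}
       := by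
  decide

theorem sym_four (a b c d : A) : sym K ![a, b, c, d] = (1 / 24 : K) •
      (a * b * c * d + a * b * d * c + a * c * b * d + a * c * d * b + a * d * b * c + a * d * c * b + b * a * c * d + b * a * d * c +
       b * c * a * d + b * c * d * a + b * d * a * c + b * d * c * a + c * a * b * d + c * a * d * b + c * b * a * d + c * b * d * a +
       c * d * a * b + c * d * b * a + d * a * b * c + d * a * c * b + d * b * a * c + d * b * c * a + d * c * a * b + d * c * b * a) := by
  have hf : ((Nat.factorial 4 : ℕ) : K)⁻¹ = 1 / 24 := by norm_num [Nat.factorial]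
  have hs := congrArg (fun s => (s.map fun q : Fin 4 × Fin 4 × Fin 4 × Fin 4 =>
    ![a, b, c, d] q.1 * ![a, b, c, d] q.2.1 * ![a, b, c, d] q.2.2.1 *
      ![a, b, c, d] q.2.2.2).sum) perm_fin_four_values
  rw [sym, hf]
  congr 1
  refine Eq.trans ?_ (hs.trans ?_)
  · rw [Multiset.map_map]
    rfl
  · simp only [Multiset.insert_eq_cons, Multiset.map_cons, Multiset.map_singleton,
      Multiset.sum_cons, Multiset.sum_singleton]
    simp only [Matrix.cons_val]
    abel

variable [CharZero K] [IsScalarTower K A A] [SMulCommClass K A A]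

theorem diamond_diamond (a b₁ b₂ : A) :
    diamond K a (diamond K b₁ b₂) =
      sym K ![a, b₁, b₂] + (1 / 12 : K) • (⁅⁅a, b₁⁆, b₂⁆ + ⁅⁅a, b₂⁆, b₁⁆) := by
  rw [sym_three]
  simp only [diamond, Ring.lie_def, mul_add, add_mul, mul_sub, sub_mul, mul_smul_comm,
    smul_mul_assoc, mul_assoc]
  module

theorem diamond_sym_three (a b₁ b₂ b₃ : A) :
    diamond K a (sym K ![b₁, b₂, b₃]) = sym K ![a, b₁, b₂, b₃] + (1 / 12 : K) •
      (diamond K b₁ (⁅⁅a, b₂⁆, b₃⁆ + ⁅⁅a, b₃⁆, b₂⁆) +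
       diamond K b₂ (⁅⁅a, b₁⁆, b₃⁆ + ⁅⁅a, b₃⁆, b₁⁆) +
       diamond K b₃ (⁅⁅a, b₁⁆, b₂⁆ + ⁅⁅a, b₂⁆, b₁⁆)) := by
  rw [sym_three, sym_four]
  simp only [diamond, Ring.lie_def, mul_add, add_mul, mul_sub, sub_mul, mul_smul_comm,
    smul_mul_assoc, mul_assoc]
  module

end Expansion

/-! ### Descent from the unitization -/

section NonUnital

variable (K : Type*) {A : Type*} [Field K] [CharZero K] [NonUnitalRing A] [Module K A]
  [IsScalarTower K A A] [SMulCommClass K A A]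

theorem diamond_sym_of_nonUnital {k : ℕ} (hk : k ≠ 0) (a : A) (b : Fin k → A) :
    diamond K a (sym K b) = sym K (Fin.cons a b : Fin (k + 1) → A) +
      ∑ h ∈ Finset.Icc 1 (k / 2), (coeff h : K) • commSum K h a b := by
  let φ : A →ₙₐ[K] Unitization K A := Unitization.inrNonUnitalAlgHom K A
  have hφ : Function.Injective φ := Unitization.inr_injective
  apply hφ
  rw [map_diamond, map_sym, diamond_sym K hk, map_add, map_sym, map_cons_apply, map_sum]
  simp only [map_smul, map_commSum]

end NonUnital

end SymProd

theorem mainTheorem6 (K : Type*) (A : Type*) [Field K] [CharZero K] [NonUnitalRing A]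
    [Module K A] [IsScalarTower K A A] [SMulCommClass K A A] :
    -- the case of two factors
    (∀ a b₁ b₂ : A,
      SymProd.diamond K a (SymProd.diamond K b₁ b₂) =
        SymProd.sym K ![a, b₁, b₂] + (1 / 12 : K) • (⁅⁅a, b₁⁆, b₂⁆ + ⁅⁅a, b₂⁆, b₁⁆)) ∧
    -- the case of three factors
    (∀ a b₁ b₂ b₃ : A,
      SymProd.diamond K a (SymProd.sym K ![b₁, b₂, b₃]) =
        SymProd.sym K ![a, b₁, b₂, b₃] + (1 / 12 : K) •
          (SymProd.diamond K b₁ (⁅⁅a, b₂⁆, b₃⁆ + ⁅⁅a, b₃⁆, b₂⁆) +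
           SymProd.diamond K b₂ (⁅⁅a, b₁⁆, b₃⁆ + ⁅⁅a, b₃⁆, b₁⁆) +
           SymProd.diamond K b₃ (⁅⁅a, b₁⁆, b₂⁆ + ⁅⁅a, b₂⁆, b₁⁆))) ∧
    -- the general formula
    (∀ (k : ℕ), 1 ≤ k → ∀ (a : A) (b : Fin k → A),
      SymProd.diamond K a (SymProd.sym K b) =
        SymProd.sym K (Fin.cons a b : Fin (k + 1) → A) +
          ∑ h ∈ Finset.Icc 1 (k / 2), (SymProd.coeff h : K) • SymProd.commSum K h a b) ∧
    -- the recursion for the coefficients, and their first values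
    SymProd.coeff 1 = 1 / 12 ∧
    (∀ h : ℕ, 1 < h → SymProd.coeff h =
      -(1 / (2 * (h : ℚ) + 1)) *
        ∑ i ∈ Finset.Icc 1 (h - 1), SymProd.coeff i * SymProd.coeff (h - i)) ∧
    SymProd.coeff 2 = -1 / 720 ∧
    SymProd.coeff 3 = 1 / 30240 ∧
    SymProd.coeff 4 = -1 / 1209600 ∧
    SymProd.coeff 5 = 1 / 47900160 :=
  ⟨SymProd.diamond_diamond K, SymProd.diamond_sym_three K,
    fun _ hk => SymProd.diamond_sym_of_nonUnital K (Nat.one_le_iff_ne_zero.1 hk),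
    SymProd.coeff_one, SymProd.coeff_rec, SymProd.coeff_two, SymProd.coeff_three,
    SymProd.coeff_four, SymProd.coeff_five⟩
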